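/- All graphs are finite and simple. In a connected graph $G$ with distance $d$, a set $S$ of vertices is a *resolving set* if for any two distinct vertices $x,y$ there is $u\in S$ with $d(u,x)\neq d(u,y)$; it is *minimal* if no proper subset of it is a resolving set. The *metric dimension* $\dim(G)$ is the smallest size of a resolving set, and the *upper dimension* $\dim^+(G)$ is the largest size of a minimal resolving set. The $p\times q$ grid is the graph with vertex set $\{0,\dots,p-1\}\times\{0,\dots,q-1\}$ in which two vertices are adjacent if and only if they agree in one coordinate and differ by exactly $1$ in the other. **Theorem.** For all integers $a,b$ with $2\le a\le b$ there is a connected graph $G$ with $\dim(G)=a$ and $\dim^+(G)=b$. Moreover, $G$ can be chosen as follows: for some integer $\ell\ge 2$, take the $\ell\times\ell$ grid or the $(\ell-1)\times\ell$ grid (the $\ell\times\ell$ grid with one column removed), and attach at the origin $(0,0)$ either a triangle (two new vertices adjacent to each other and to $(0,0)$) or $m$ pendant vertices (new vertices adjacent only to $(0,0)$) for some integer $m\ge 2$. -/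

import Mathlib

/-- The vertex `u` resolves the pair `x`, `y` if its distances to them differ. -/
def Resolves {V : Type*} (G : SimpleGraph V) (u x y : V) : Prop :=
  G.dist u x ≠ G.dist u y

/-- `S` is a resolving set of `G`: any two distinct vertices are resolved by a vertex of `S`. -/
def IsResolvingSet {V : Type*} (G : SimpleGraph V) (S : Finset V) : Prop :=
  ∀ x y : V, x ≠ y → ∃ u ∈ S, Resolves G u x y

/-- A minimal resolving set: no proper subset of it is a resolving set. -/
def IsMinimalResolvingSet {V : Type*} (G : SimpleGraph V) (S : Finset V) : Prop :=
  IsResolvingSet G S ∧ ∀ T : Finset V, T ⊂ S → ¬ IsResolvingSet G T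

/-- The metric dimension of a finite graph: the least size of a resolving set. -/
noncomputable def metricDimension {V : Type*} (G : SimpleGraph V) : ℕ :=
  sInf {n : ℕ | ∃ S : Finset V, IsResolvingSet G S ∧ S.card = n}

/-- The upper dimension of a finite graph: the largest size of a minimal resolving set. -/
noncomputable def upperDimension {V : Type*} (G : SimpleGraph V) : ℕ :=
  sSup {n : ℕ | ∃ S : Finset V, IsMinimalResolvingSet G S ∧ S.card = n}

/-- The grid graph with vertex set `{0, …, p - 1} × {0, …, q - 1}`. -/
def grid (p q : ℕ) : SimpleGraph (Fin p × Fin q) :=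
  SimpleGraph.boxProd (SimpleGraph.pathGraph p) (SimpleGraph.pathGraph q)

/-- The disjoint union of the `p × q` grid and of the graph `K`, with all edges added that join
the origin `(0, 0)` of the grid to a vertex of `K`. -/
def attachAtOrigin (p q : ℕ) {W : Type} (K : SimpleGraph W) :
    SimpleGraph ((Fin p × Fin q) ⊕ W) where
  Adj
    | Sum.inl x, Sum.inl y => (grid p q).Adj x y
    | Sum.inr i, Sum.inr j => K.Adj i j
    | Sum.inl x, Sum.inr _ => x.1.val = 0 ∧ x.2.val = 0
    | Sum.inr _, Sum.inl x => x.1.val = 0 ∧ x.2.val = 0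
  symm := ⟨by
    rintro (x | i) (y | j) h
    · exact SimpleGraph.Adj.symm h
    · exact h
    · exact h
    · exact SimpleGraph.Adj.symm h⟩
  loopless := ⟨by
    rintro (x | i) h
    · exact (grid p q).irrefl h
    · exact K.irrefl h⟩

/-- The `p × q` grid with a triangle attached at the origin. -/
def gridWithTriangle (p q : ℕ) : SimpleGraph ((Fin p × Fin q) ⊕ Fin 2) :=
  attachAtOrigin p q (⊤ : SimpleGraph (Fin 2))

/-- The `p × q` grid with `m` pendant vertices attached at the origin. -/
def gridWithPendants (p q m : ℕ) : SimpleGraph ((Fin p × Fin q) ⊕ Fin m) :=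
  attachAtOrigin p q (⊥ : SimpleGraph (Fin m))

/-- `G` is, up to isomorphism, an `ℓ × ℓ` grid or an `ℓ × ℓ` grid with one column removed
(`ℓ ≥ 2`), with a triangle or with `m ≥ 2` pendant vertices attached at the origin. -/
def IsExtendedGrid {V : Type*} (G : SimpleGraph V) : Prop :=
  ∃ ℓ p : ℕ, 2 ≤ ℓ ∧ (p = ℓ ∨ p + 1 = ℓ) ∧
    (Nonempty (G ≃g gridWithTriangle p ℓ) ∨
      ∃ m : ℕ, 2 ≤ m ∧ Nonempty (G ≃g gridWithPendants p ℓ m))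

/-! A new vertex sees only coordinate sums on the grid, so the grid part `T` of a resolving set must
resolve pairs on a common antidiagonal. This holds exactly when `T` resolves the antidiagonal of
every unit square, a condition on pairs of inequalities. One corner `(0, q - 1)` or `(p - 1, 0)`
already suffices, which keeps the metric dimension small; a minimal `T` can nevertheless be as large
as `p + q - 3`.

That bound is the heart of the proof: `card_le_of_minimal_separatesSquares` injects `T` into the
coordinate sums of unit squares, and the staircase in `exists_minimal_separatesSquares` attains it.

A triangle adds one vertex to any minimal resolving set, giving dimensions `2` and `p + q - 2`. With
`m` pendants at most one may be left out, and then the grid part must also tell it from `(0, 1)` and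
`(1, 0)`. This gives `m + 1` and, once `p + q ≥ 5`, `m + p + q - 4`. -/

namespace SimpleGraph

/-- A function vanishing exactly at `u`, growing by at most one along edges, and with a strictly
descending neighbour at every other vertex, is the distance from `u`. -/
theorem reachable_and_dist_eq_of_potential {V : Type*} (G : SimpleGraph V) (u : V) (f : V → ℕ)
    (h0 : ∀ v, f v = 0 ↔ v = u) (h1 : ∀ v w, G.Adj v w → f w ≤ f v + 1)
    (h2 : ∀ v, f v ≠ 0 → ∃ w, G.Adj v w ∧ f w + 1 = f v) (v : V) :
    G.Reachable u v ∧ G.dist u v = f v := by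
  have hle : ∀ {x y : V} (c : G.Walk x y), f y ≤ f x + c.length := by
    intro x y c
    induction c with
    | nil => simp
    | cons h c ih =>
      have := h1 _ _ h
      rw [Walk.length_cons]
      omega
  have hwalk : ∀ n v, f v = n → ∃ c : G.Walk v u, c.length = n := by
    intro n
    induction n with
    | zero =>
      intro v hv
      obtain rfl := (h0 v).1 hv
      exact ⟨Walk.nil, rfl⟩
    | succ n ih =>
      intro v hv
      obtain ⟨w, hw, hf⟩ := h2 v (by omega)
      obtain ⟨c, hc⟩ := ih w (by omega)
      exact ⟨Walk.cons hw c, by rw [Walk.length_cons, hc]⟩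
  obtain ⟨c, hc⟩ := hwalk _ v rfl
  have hr : G.Reachable u v := ⟨c.reverse⟩
  refine ⟨hr, le_antisymm ?_ ?_⟩
  · rw [← hc, ← Walk.length_reverse]
    exact dist_le _
  · obtain ⟨d, hd⟩ := hr.exists_walk_length_eq_dist
    have := hle d
    rw [(h0 u).2 rfl] at this
    omega

end SimpleGraph

/-! ### Distances in the extended grid -/

/-- The distance on the natural numbers. -/
def natDist (a b : ℕ) : ℕ := (a - b) + (b - a)

/-- The distance in the extended grid whose new vertices are at mutual distance `c`. -/
def attachDist {p q : ℕ} {W : Type} [DecidableEq W] (c : ℕ) :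
    (Fin p × Fin q) ⊕ W → (Fin p × Fin q) ⊕ W → ℕ
  | Sum.inl x, Sum.inl y => natDist x.1 y.1 + natDist x.2 y.2
  | Sum.inl x, Sum.inr _ => x.1 + x.2 + 1
  | Sum.inr _, Sum.inl x => x.1 + x.2 + 1
  | Sum.inr i, Sum.inr j => if i = j then 0 else c

theorem grid_adj_iff {p q : ℕ} (x y : Fin p × Fin q) :
    (grid p q).Adj x y ↔
      ((x.1.val + 1 = y.1.val ∨ y.1.val + 1 = x.1.val) ∧ x.2.val = y.2.val) ∨
      ((x.2.val + 1 = y.2.val ∨ y.2.val + 1 = x.2.val) ∧ x.1.val = y.1.val) := by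
  simp only [grid, SimpleGraph.boxProd_adj, SimpleGraph.pathGraph_adj, Fin.ext_iff]

theorem grid_exists_descent {p q : ℕ} (x y : Fin p × Fin q)
    (h : natDist x.1 y.1 + natDist x.2 y.2 ≠ 0) :
    ∃ z : Fin p × Fin q, (grid p q).Adj y z ∧
      natDist x.1 z.1 + natDist x.2 z.2 + 1 = natDist x.1 y.1 + natDist x.2 y.2 := by
  obtain ⟨⟨a, ha⟩, ⟨b, hb⟩⟩ := x
  obtain ⟨⟨c, hc⟩, ⟨d, hd⟩⟩ := y
  simp only [natDist] at h ⊢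
  rcases lt_trichotomy a c with h1 | h1 | h1
  · exact ⟨(⟨c - 1, by omega⟩, ⟨d, hd⟩), by rw [grid_adj_iff]; dsimp only; omega, by dsimp only; omega⟩
  · rcases lt_trichotomy b d with h2 | h2 | h2
    · exact ⟨(⟨c, hc⟩, ⟨d - 1, by omega⟩), by rw [grid_adj_iff]; dsimp only; omega, by dsimp only; omega⟩
    · omega
    · exact ⟨(⟨c, hc⟩, ⟨d + 1, by omega⟩), by rw [grid_adj_iff]; dsimp only; omega, by dsimp only; omega⟩
  · exact ⟨(⟨c + 1, by omega⟩, ⟨d, hd⟩), by rw [grid_adj_iff]; dsimp only; omega, by dsimp only; omega⟩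

theorem attachAtOrigin_reachable_and_dist {p q : ℕ} (hp : 0 < p) (hq : 0 < q) {W : Type}
    [DecidableEq W] (K : SimpleGraph W) (c : ℕ)
    (hK : (c = 1 ∧ K = ⊤) ∨ (c = 2 ∧ K = ⊥)) (u v : (Fin p × Fin q) ⊕ W) :
    (attachAtOrigin p q K).Reachable u v ∧ (attachAtOrigin p q K).dist u v = attachDist c u v := by
  have hc : c ≠ 0 := by omega
  let o : Fin p × Fin q := (⟨0, hp⟩, ⟨0, hq⟩)
  refine SimpleGraph.reachable_and_dist_eq_of_potential _ u (attachDist c u) ?_ ?_ ?_ v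
  · rintro v
    rcases u with x | i <;> rcases v with y | j
    · simp only [attachDist, natDist, Sum.inl.injEq, Prod.ext_iff, Fin.ext_iff]
      omega
    · simp [attachDist]
    · simp [attachDist]
    · simp [attachDist, hc, eq_comm]
  · rintro (y | j) (z | k) h
    · have h' : (grid p q).Adj y z := h
      rw [grid_adj_iff] at h'
      rcases u with x | i <;> simp only [attachDist, natDist] <;> omega
    · have h' : y.1.val = 0 ∧ y.2.val = 0 := h
      rcases u with x | i
      · simp only [attachDist, natDist]
        omega
      · simp only [attachDist]
        split_ifs <;> omega
    · have h' : z.1.val = 0 ∧ z.2.val = 0 := h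
      rcases u with x | i
      · simp only [attachDist, natDist]
        omega
      · simp only [attachDist]
        split_ifs <;> omega
    · have h' : K.Adj j k := h
      rcases u with x | i
      · simp only [attachDist]
        omega
      · rcases hK with ⟨rfl, rfl⟩ | ⟨rfl, rfl⟩
        · simp only [attachDist]
          split_ifs <;> omega
        · exact absurd h' (by simp)
  · rintro (y | j) h
    · rcases u with x | i
      · obtain ⟨z, hz, hd⟩ := grid_exists_descent x y h
        exact ⟨Sum.inl z, hz, hd⟩
      · by_cases hy : natDist o.1 y.1 + natDist o.2 y.2 = 0
        · simp only [natDist, o] at hy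
          refine ⟨Sum.inr i, (⟨by omega, by omega⟩ : y.1.val = 0 ∧ y.2.val = 0), ?_⟩
          simp only [attachDist, if_true]
          omega
        · obtain ⟨z, hz, hd⟩ := grid_exists_descent o y hy
          refine ⟨Sum.inl z, hz, ?_⟩
          simp only [natDist, o] at hd
          simp only [attachDist]
          omega
    · rcases u with x | i
      · exact ⟨Sum.inl o, (⟨rfl, rfl⟩ : o.1.val = 0 ∧ o.2.val = 0), by simp [attachDist, natDist, o]⟩
      · by_cases hij : i = j
        · simp [attachDist, hij] at h
        · rcases hK with ⟨rfl, rfl⟩ | ⟨rfl, rfl⟩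
          · exact ⟨Sum.inr i, (SimpleGraph.top_adj _ _).2 (Ne.symm hij), by simp [attachDist, hij]⟩
          · exact ⟨Sum.inl o, (⟨rfl, rfl⟩ : o.1.val = 0 ∧ o.2.val = 0),
              by simp [attachDist, hij, o]⟩

theorem attachAtOrigin_connected {p q : ℕ} (hp : 0 < p) (hq : 0 < q) {W : Type}
    [DecidableEq W] (K : SimpleGraph W) (c : ℕ) (hK : (c = 1 ∧ K = ⊤) ∨ (c = 2 ∧ K = ⊥)) :
    (attachAtOrigin p q K).Connected :=
  haveI : Nonempty ((Fin p × Fin q) ⊕ W) := ⟨Sum.inl (⟨0, hp⟩, ⟨0, hq⟩)⟩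
  ⟨fun u v => (attachAtOrigin_reachable_and_dist hp hq K c hK u v).1⟩

/-! ### Separating the unit squares -/

/-- The grid vertex `w` is at different distances from the ends `(x, y + 1)` and `(x + 1, y)` of
the antidiagonal of the unit square with lower corner `(x, y)`. -/
def SeparatesSquare {p q : ℕ} (w : Fin p × Fin q) (x y : ℕ) : Prop :=
  (w.1.val ≤ x ∧ y < w.2.val) ∨ (x < w.1.val ∧ w.2.val ≤ y)

/-- Every unit square of the grid is separated by an element of `T`. -/
def SeparatesSquares {p q : ℕ} (T : Finset (Fin p × Fin q)) : Prop :=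
  ∀ x y : ℕ, x + 1 < p → y + 1 < q → ∃ w ∈ T, SeparatesSquare w x y

theorem natDist_add_ne_of_separatesSquare {p q : ℕ} {w g h : Fin p × Fin q}
    (hgh : g.1.val < h.1.val) (hs : g.1.val + g.2.val = h.1.val + h.2.val)
    (hw : SeparatesSquare w g.1 h.2) :
    natDist w.1 g.1 + natDist w.2 g.2 ≠ natDist w.1 h.1 + natDist w.2 h.2 := by
  simp only [SeparatesSquare] at hw
  simp only [natDist]
  omega

theorem separatesSquare_of_natDist_add_ne {p q : ℕ} {w : Fin p × Fin q} {x y : ℕ}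
    (h : natDist w.1 x + natDist w.2 (y + 1) ≠ natDist w.1 (x + 1) + natDist w.2 y) :
    SeparatesSquare w x y := by
  simp only [SeparatesSquare]
  simp only [natDist] at h
  omega

/-- A family of points all of which are needed to separate the unit squares of a grid has at most
`p + q - 3` members: send each point to the least coordinate sum of a square only it separates. -/
theorem card_le_of_minimal_separatesSquares {p q : ℕ} {T : Finset (Fin p × Fin q)}
    (hT : SeparatesSquares T)
    (hmin : ∀ T' ⊆ T, SeparatesSquares T' → T' = T) : T.card ≤ p + q - 3 := by
  classical
  let Priv (w : Fin p × Fin q) (s : ℕ) : Prop := ∃ x y : ℕ, x + 1 < p ∧ y + 1 < q ∧ x + y = s ∧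
    SeparatesSquare w x y ∧ ∀ w' ∈ T, w' ≠ w → ¬ SeparatesSquare w' x y
  have hex : ∀ w ∈ T, ∃ s, Priv w s := by
    intro w hw
    by_contra hno
    have : SeparatesSquares (T.erase w) := by
      intro x y hx hy
      by_contra hnone
      refine hno ⟨x + y, x, y, hx, hy, rfl, ?_, ?_⟩
      · obtain ⟨w', hw', hs⟩ := hT x y hx hy
        by_cases hww : w' = w
        · exact hww ▸ hs
        · exact absurd ⟨w', Finset.mem_erase.2 ⟨hww, hw'⟩, hs⟩ hnone
      · intro w' hw' hne hs
        exact hnone ⟨w', Finset.mem_erase.2 ⟨hne, hw'⟩, hs⟩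
    have := hmin _ (Finset.erase_subset w T) this
    rw [← this] at hw
    exact absurd hw (Finset.notMem_erase w T)
  choose! σ hσ using fun w hw => (⟨Nat.find (hex w hw), Nat.find_spec (hex w hw),
    fun t ht => Nat.find_min' (hex w hw) ht⟩ : ∃ s, Priv w s ∧ ∀ t, Priv w t → s ≤ t)
  -- Two private squares on one antidiagonal, at `(x, y)` and `(x', y')`, span a rectangle with
  -- lower corner square `(x, y')` and upper corner square `(x', y)`. A point separating either of
  -- these two separates one of the given squares, so only `w` and `w'` can.
  have key : ∀ w ∈ T, ∀ w' ∈ T, w ≠ w' → ∀ x y x' y' : ℕ, x < x' → x + y = x' + y' →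
      x' + 1 < p → y + 1 < q → σ w = x + y → σ w' = x + y →
      SeparatesSquare w x y → (∀ v ∈ T, v ≠ w → ¬ SeparatesSquare v x y) →
      SeparatesSquare w' x' y' → (∀ v ∈ T, v ≠ w' → ¬ SeparatesSquare v x' y') → False := by
    intro w hw w' hw' hne x y x' y' hx hs hxp hyq hsw hsw' h1 h2 h3 h4
    have hother : ∀ v ∈ T, v ≠ w → v ≠ w' →
        ¬ SeparatesSquare v x y' ∧ ¬ SeparatesSquare v x' y := by
      intro v hv hvw hvw'
      have e1 := h2 v hv hvw
      have e2 := h4 v hv hvw'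
      simp only [SeparatesSquare] at e1 e2 ⊢
      omega
    have e1 := h2 w' hw' (Ne.symm hne)
    have e2 := h4 w hw hne
    obtain ⟨v, hv, hvs⟩ := hT x y' (by omega) (by omega)
    obtain ⟨z, hz, hzs⟩ := hT x' y (by omega) (by omega)
    have hv' : v = w ∨ v = w' := by
      by_contra hcon
      push Not at hcon
      exact (hother v hv hcon.1 hcon.2).1 hvs
    have hz' : z = w ∨ z = w' := by
      by_contra hcon
      push Not at hcon
      exact (hother z hz hcon.1 hcon.2).2 hzs
    -- If both `w` and `w'` separated the lower square, neither would separate the upper one. So the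
    -- lower square is private to one of them, with a smaller sum than its `σ`.
    have hcase : (SeparatesSquare w x y' ∧ ¬ SeparatesSquare w' x y') ∨
        (SeparatesSquare w' x y' ∧ ¬ SeparatesSquare w x y') := by
      rcases hv' with rfl | rfl <;> rcases hz' with rfl | rfl <;>
        simp only [SeparatesSquare] at * <;> omega
    rcases hcase with ⟨g1, g2⟩ | ⟨g1, g2⟩
    · have := (hσ w hw).2 (x + y') ⟨x, y', by omega, by omega, rfl, g1, fun v hv hvw => by
        by_cases hvw' : v = w'
        · exact hvw' ▸ g2
        · exact (hother v hv hvw hvw').1⟩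
      omega
    · have := (hσ w' hw').2 (x + y') ⟨x, y', by omega, by omega, rfl, g1, fun v hv hvw' => by
        by_cases hvw : v = w
        · exact hvw ▸ g2
        · exact (hother v hv hvw hvw').1⟩
      omega
  have hinj : Set.InjOn σ T := by
    intro w hw w' hw' hww
    by_contra hne
    obtain ⟨x, y, hx, hy, hs, h1, h2⟩ := (hσ w hw).1
    obtain ⟨x', y', hx', hy', hs', h3, h4⟩ := (hσ w' hw').1
    rcases lt_trichotomy x x' with hlt | heq | hlt
    · exact key w hw w' hw' hne x y x' y' hlt (by omega) hx' hy hs.symm (by omega) h1 h2 h3 h4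
    · obtain rfl := heq
      obtain rfl : y = y' := by omega
      exact h2 w' hw' (Ne.symm hne) h3
    · exact key w' hw' w hw (Ne.symm hne) x' y' x y hlt (by omega) hx hy' hs'.symm (by omega)
        h3 h4 h1 h2
  -- Lower corners of squares have coordinate sums from `0` to `(p - 2) + (q - 2)`.
  have hmaps : ∀ w ∈ T, σ w ∈ Finset.range (p + q - 3) := by
    intro w hw
    obtain ⟨x, y, hx, hy, hs, -⟩ := (hσ w hw).1
    rw [Finset.mem_range]
    omega
  simpa using Finset.card_le_card_of_injOn σ hmaps hinj

/-- The staircase `(0, 1), (1, 1), (1, 2), (2, 2), …` with `p + q - 3` points is a minimal family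
separating the unit squares. -/
theorem exists_minimal_separatesSquares {p q : ℕ} (hp : 2 ≤ p) (hpq : p = q ∨ p + 1 = q) :
    ∃ T : Finset (Fin p × Fin q), SeparatesSquares T ∧
      (∀ T' ⊆ T, SeparatesSquares T' → T' = T) ∧ T.card = p + q - 3 ∧
      (5 ≤ p + q → ∀ w ∈ T, ¬ (w.1.val = 0 ∧ w.2.val = q - 1) ∧
        ¬ (w.1.val = p - 1 ∧ w.2.val = 0)) := by
  classical
  let f : Fin (p + q - 3) → Fin p × Fin q := fun k =>
    (⟨(k.val + 1) / 2, by omega⟩, ⟨(k.val + 2) / 2, by omega⟩)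
  have hf : Function.Injective f := by
    intro k l h
    simp only [f, Prod.mk.injEq, Fin.mk.injEq] at h
    exact Fin.ext (by omega)
  refine ⟨Finset.univ.image f, ?_, ?_, ?_, ?_⟩
  · intro x y hx hy
    by_cases hxy : y ≤ x
    · refine ⟨f ⟨2 * x, by omega⟩, Finset.mem_image_of_mem _ (Finset.mem_univ _), ?_⟩
      simp only [SeparatesSquare, f]
      omega
    · refine ⟨f ⟨2 * x + 1, by omega⟩, Finset.mem_image_of_mem _ (Finset.mem_univ _), ?_⟩
      simp only [SeparatesSquare, f]
      omega
  · intro T' hsub hT'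
    refine Finset.Subset.antisymm hsub fun w hw => ?_
    obtain ⟨k, -, rfl⟩ := Finset.mem_image.1 hw
    -- This square, of coordinate sum `k`, is separated by the `k`-th stair point only.
    obtain ⟨v, hv, hs⟩ := hT' (k.val / 2) ((k.val + 1) / 2) (by omega) (by omega)
    obtain ⟨l, -, rfl⟩ := Finset.mem_image.1 (hsub hv)
    have : l = k := by
      simp only [SeparatesSquare, f] at hs
      exact Fin.ext (by omega)
    exact this ▸ hv
  · rw [Finset.card_image_of_injective _ hf, Finset.card_univ, Fintype.card_fin]
  · intro h5 w hw
    obtain ⟨k, -, rfl⟩ := Finset.mem_image.1 hw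
    simp only [f]
    omega

/-- Seen from either of these corners, the distance is strictly monotone along each antidiagonal. -/
theorem separatesSquares_of_corner_mem {p q : ℕ} {T : Finset (Fin p × Fin q)}
    {w : Fin p × Fin q} (hw : w ∈ T)
    (h : (w.1.val = 0 ∧ w.2.val = q - 1) ∨ (w.1.val = p - 1 ∧ w.2.val = 0)) :
    SeparatesSquares T := by
  intro x y hx hy
  refine ⟨w, hw, ?_⟩
  simp only [SeparatesSquare]
  omega

/-- On an axis, only the end corner separates the last unit square along that axis. -/
theorem SeparatesSquares.exists_pos_of_no_corner {p q : ℕ} (hp : 2 ≤ p) (hq : 2 ≤ q)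
    {T : Finset (Fin p × Fin q)} (hT : SeparatesSquares T)
    (h : ∀ w ∈ T, ¬ (w.1.val = 0 ∧ w.2.val = q - 1) ∧ ¬ (w.1.val = p - 1 ∧ w.2.val = 0)) :
    (∃ w ∈ T, 0 < w.1.val) ∧ ∃ w ∈ T, 0 < w.2.val := by
  constructor
  · obtain ⟨w, hw, hs⟩ := hT 0 (q - 2) (by omega) (by omega)
    have := h w hw
    refine ⟨w, hw, ?_⟩
    simp only [SeparatesSquare] at hs
    omega
  · obtain ⟨w, hw, hs⟩ := hT (p - 2) 0 (by omega) (by omega)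
    have := h w hw
    refine ⟨w, hw, ?_⟩
    simp only [SeparatesSquare] at hs
    omega

theorem SeparatesSquares.nonempty {p q : ℕ} (hp : 2 ≤ p) (hq : 2 ≤ q)
    {T : Finset (Fin p × Fin q)} (hT : SeparatesSquares T) : T.Nonempty := by
  obtain ⟨w, hw, -⟩ := hT 0 0 (by omega) (by omega)
  exact ⟨w, hw⟩

theorem exists_natDist_add_ne_of_separatesSquares {p q : ℕ} {T : Finset (Fin p × Fin q)}
    (hT : SeparatesSquares T) (g h : Fin p × Fin q) (hs : g.1.val + g.2.val = h.1.val + h.2.val)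
    (hgh : g ≠ h) :
    ∃ w ∈ T, natDist w.1 g.1 + natDist w.2 g.2 ≠ natDist w.1 h.1 + natDist w.2 h.2 := by
  rcases lt_trichotomy g.1.val h.1.val with h1 | h1 | h1
  · obtain ⟨w, hw, hws⟩ := hT g.1 h.2 (by omega) (by omega)
    exact ⟨w, hw, natDist_add_ne_of_separatesSquare h1 hs hws⟩
  · exact absurd (Prod.ext (Fin.ext h1) (Fin.ext (by omega))) hgh
  · obtain ⟨w, hw, hws⟩ := hT h.1 g.2 (by omega) (by omega)
    exact ⟨w, hw, (natDist_add_ne_of_separatesSquare h1 hs.symm hws).symm⟩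

/-! ### Characterizing the resolving sets -/

section AttachDist

variable {p q : ℕ} {W : Type} [DecidableEq W] {c : ℕ}

/-- A set resolves with respect to a distance function on vertices. -/
def ResolvesWith {V : Type*} (d : V → V → ℕ) (S : Finset V) : Prop :=
  ∀ x y : V, x ≠ y → ∃ u ∈ S, d u x ≠ d u y

theorem isResolvingSet_iff_resolvesWith (hp : 0 < p) (hq : 0 < q) (K : SimpleGraph W)
    (hK : (c = 1 ∧ K = ⊤) ∨ (c = 2 ∧ K = ⊥)) (S : Finset ((Fin p × Fin q) ⊕ W)) :
    IsResolvingSet (attachAtOrigin p q K) S ↔ ResolvesWith (attachDist c) S := by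
  simp only [IsResolvingSet, ResolvesWith, Resolves,
    (attachAtOrigin_reachable_and_dist hp hq K c hK _ _).2]

theorem ResolvesWith.mem_or_mem {S : Finset ((Fin p × Fin q) ⊕ W)}
    (hS : ResolvesWith (attachDist c) S) {i j : W} (hij : i ≠ j) :
    Sum.inr i ∈ S ∨ Sum.inr j ∈ S := by
  obtain ⟨u, hu, h⟩ := hS (Sum.inr i) (Sum.inr j) (by simpa using hij)
  rcases u with x | k
  · simp [attachDist] at h
  · by_cases h1 : k = i
    · exact Or.inl (h1 ▸ hu)
    · by_cases h2 : k = j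
      · exact Or.inr (h2 ▸ hu)
      · simp [attachDist, h1, h2] at h

theorem ResolvesWith.separatesSquares {S : Finset ((Fin p × Fin q) ⊕ W)}
    (hS : ResolvesWith (attachDist c) S) : SeparatesSquares S.toLeft := by
  intro x y hx hy
  obtain ⟨u, hu, h⟩ := hS (Sum.inl (⟨x, by omega⟩, ⟨y + 1, hy⟩))
    (Sum.inl (⟨x + 1, hx⟩, ⟨y, by omega⟩)) (by simp)
  rcases u with w | k
  · exact ⟨w, Finset.mem_toLeft.2 hu, separatesSquare_of_natDist_add_ne h⟩
  · simp only [attachDist] at h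
    omega

theorem exists_attachDist_inl_inl_ne {S : Finset ((Fin p × Fin q) ⊕ W)}
    (hT : SeparatesSquares S.toLeft) {i : W} (hi : Sum.inr i ∈ S) {g h : Fin p × Fin q}
    (hgh : g ≠ h) :
    ∃ u ∈ S, attachDist c u (Sum.inl g) ≠ attachDist c u (Sum.inl h) := by
  by_cases hs : g.1.val + g.2.val = h.1.val + h.2.val
  · obtain ⟨w, hw, hne⟩ := exists_natDist_add_ne_of_separatesSquares hT g h hs hgh
    exact ⟨Sum.inl w, Finset.mem_toLeft.1 hw, hne⟩
  · refine ⟨Sum.inr i, hi, ?_⟩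
    simp only [attachDist]
    omega

theorem exists_attachDist_inr_inr_ne (hc : c ≠ 0) {S : Finset ((Fin p × Fin q) ⊕ W)}
    {i j : W} (hij : i ≠ j) (h : Sum.inr i ∈ S ∨ Sum.inr j ∈ S) :
    ∃ u ∈ S, attachDist c u (Sum.inr i : (Fin p × Fin q) ⊕ W) ≠ attachDist c u (Sum.inr j) := by
  rcases h with h | h
  · exact ⟨_, h, by simpa [attachDist, hij] using hc.symm⟩
  · exact ⟨_, h, by simpa [attachDist, hij.symm] using hc⟩

/-- If the vertices of `W` are resolved among themselves and the grid vertices too, it remains to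
resolve grid vertices from elements of `W`. -/
theorem resolvesWith_of_inl_inr (hc : c ≠ 0) {S : Finset ((Fin p × Fin q) ⊕ W)}
    (hT : SeparatesSquares S.toLeft) {i₀ : W} (hi₀ : Sum.inr i₀ ∈ S)
    (hW : ∀ i j : W, i ≠ j → Sum.inr i ∈ S ∨ Sum.inr j ∈ S)
    (hgW : ∀ (g : Fin p × Fin q) (j : W), Sum.inr j ∉ S →
      ∃ u ∈ S, attachDist c u (Sum.inl g) ≠ attachDist c u (Sum.inr j)) :
    ResolvesWith (attachDist c) S := by
  have aux : ∀ (g : Fin p × Fin q) (j : W),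
      ∃ u ∈ S, attachDist c u (Sum.inl g) ≠ attachDist c u (Sum.inr j) := by
    intro g j
    by_cases hj : Sum.inr j ∈ S
    · exact ⟨_, hj, by simp [attachDist]⟩
    · exact hgW g j hj
  rintro (g | i) (h | j) hne
  · exact exists_attachDist_inl_inl_ne hT hi₀ (by simpa using hne)
  · exact aux g j
  · obtain ⟨u, hu, h⟩ := aux h i
    exact ⟨u, hu, h.symm⟩
  · have hij : i ≠ j := by simpa using hne
    exact exists_attachDist_inr_inr_ne hc hij (hW i j hij)

end AttachDist

theorem isResolvingSet_gridWithTriangle_iff {p q : ℕ} (hp : 2 ≤ p) (hq : 2 ≤ q)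
    (S : Finset ((Fin p × Fin q) ⊕ Fin 2)) :
    IsResolvingSet (gridWithTriangle p q) S ↔
      (∃ i, Sum.inr i ∈ S) ∧ SeparatesSquares S.toLeft := by
  rw [gridWithTriangle, isResolvingSet_iff_resolvesWith (c := 1) (by omega) (by omega) _
    (Or.inl ⟨rfl, rfl⟩)]
  constructor
  · intro hS
    refine ⟨?_, hS.separatesSquares⟩
    rcases hS.mem_or_mem (show (0 : Fin 2) ≠ 1 by decide) with h | h
    exacts [⟨_, h⟩, ⟨_, h⟩]
  · rintro ⟨⟨i, hi⟩, hT⟩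
    refine resolvesWith_of_inl_inr one_ne_zero hT hi ?_ ?_
    · intro j k hjk
      have : i = j ∨ i = k := by omega
      rcases this with rfl | rfl
      exacts [Or.inl hi, Or.inr hi]
    · intro g j hj
      -- Among grid vertices only the origin is as far from `i` as `j` is, and every grid vertex is
      -- nearer to the origin than to `j`.
      by_cases hg : g.1.val + g.2.val = 0
      · obtain ⟨w, hw⟩ := hT.nonempty hp hq
        refine ⟨Sum.inl w, Finset.mem_toLeft.1 hw, ?_⟩
        simp only [attachDist, natDist]
        omega
      · refine ⟨Sum.inr i, hi, ?_⟩
        have hij : i ≠ j := fun h => hj (h ▸ hi)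
        simp only [attachDist, if_neg hij]
        omega

/-- An omitted pendant is at distance `2` from the other pendants, as are `(1, 0)` and `(0, 1)`. A
grid vertex tells it from `(1, 0)` exactly when its first coordinate is positive, and from `(0, 1)`
exactly when its second one is. -/
theorem isResolvingSet_gridWithPendants_iff {p q m : ℕ} (hp : 2 ≤ p) (hq : 2 ≤ q) (hm : 2 ≤ m)
    (S : Finset ((Fin p × Fin q) ⊕ Fin m)) :
    IsResolvingSet (gridWithPendants p q m) S ↔
      (∀ i j : Fin m, i ≠ j → Sum.inr i ∈ S ∨ Sum.inr j ∈ S) ∧ SeparatesSquares S.toLeft ∧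
      ((∀ i, Sum.inr i ∈ S) ∨
        ((∃ w ∈ S.toLeft, 0 < w.1.val) ∧ ∃ w ∈ S.toLeft, 0 < w.2.val)) := by
  rw [gridWithPendants, isResolvingSet_iff_resolvesWith (c := 2) (by omega) (by omega) _
    (Or.inr ⟨rfl, rfl⟩)]
  constructor
  · intro hS
    refine ⟨fun i j => hS.mem_or_mem, hS.separatesSquares, ?_⟩
    by_contra! hcon
    obtain ⟨⟨j, hj⟩, hcon⟩ := hcon
    have aux : ∀ g : Fin p × Fin q, g.1.val + g.2.val = 1 →
        ∃ w ∈ S.toLeft, natDist w.1 g.1 + natDist w.2 g.2 ≠ w.1.val + w.2.val + 1 := by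
      intro g hg
      obtain ⟨u, hu, h⟩ := hS (Sum.inl g) (Sum.inr j) (by simp)
      rcases u with w | k
      · exact ⟨w, Finset.mem_toLeft.2 hu, h⟩
      · have hkj : k ≠ j := fun h => hj (h ▸ hu)
        simp only [attachDist, if_neg hkj] at h
        omega
    obtain ⟨w, hw, h1⟩ := aux (⟨1, by omega⟩, ⟨0, by omega⟩) rfl
    obtain ⟨v, hv, h2⟩ := aux (⟨0, by omega⟩, ⟨1, by omega⟩) rfl
    simp only [natDist] at h1 h2
    have := hcon ⟨w, hw, by omega⟩ v hv
    omega
  · rintro ⟨hW, hT, hor⟩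
    have h01 : (⟨0, by omega⟩ : Fin m) ≠ ⟨1, by omega⟩ := by simp
    obtain ⟨i, hi⟩ : ∃ i : Fin m, Sum.inr i ∈ S := by
      rcases hW _ _ h01 with h | h
      exacts [⟨_, h⟩, ⟨_, h⟩]
    refine resolvesWith_of_inl_inr two_ne_zero hT hi hW ?_
    intro g j hj
    rcases hor with hor | ⟨⟨w, hw, hw'⟩, v, hv, hv'⟩
    · exact absurd (hor j) hj
    · by_cases hg : g.1.val + g.2.val = 1
      · by_cases hg1 : g.1.val = 1
        · refine ⟨Sum.inl w, Finset.mem_toLeft.1 hw, ?_⟩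
          simp only [attachDist, natDist]
          omega
        · refine ⟨Sum.inl v, Finset.mem_toLeft.1 hv, ?_⟩
          simp only [attachDist, natDist]
          omega
      · refine ⟨Sum.inr i, hi, ?_⟩
        have hij : i ≠ j := fun h => hj (h ▸ hi)
        simp only [attachDist, if_neg hij]
        omega

/-! ### Computing the two dimensions -/

theorem metricDimension_eq {V : Type*} {G : SimpleGraph V} {n : ℕ}
    (hex : ∃ S : Finset V, IsResolvingSet G S ∧ S.card = n)
    (hle : ∀ S : Finset V, IsResolvingSet G S → n ≤ S.card) : metricDimension G = n :=
  IsLeast.csInf_eq ⟨hex, by rintro _ ⟨S, hS, rfl⟩; exact hle S hS⟩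

theorem upperDimension_eq {V : Type*} {G : SimpleGraph V} {n : ℕ}
    (hex : ∃ S : Finset V, IsMinimalResolvingSet G S ∧ S.card = n)
    (hle : ∀ S : Finset V, IsMinimalResolvingSet G S → S.card ≤ n) : upperDimension G = n :=
  IsGreatest.csSup_eq ⟨hex, by rintro _ ⟨S, hS, rfl⟩; exact hle S hS⟩

theorem isMinimalResolvingSet_iff {V : Type*} {G : SimpleGraph V} {S : Finset V} :
    IsMinimalResolvingSet G S ↔
      IsResolvingSet G S ∧ ∀ T ⊆ S, IsResolvingSet G T → T = S := by
  refine and_congr_right fun _ => ⟨fun h T hTS hT => ?_, fun h T hTS hT => ?_⟩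
  · by_contra hne
    exact h T (hTS.ssubset_of_ne hne) hT
  · exact hTS.ne (h T hTS.subset hT)

theorem metricDimension_gridWithTriangle {p q : ℕ} (hp : 2 ≤ p) (hq : 2 ≤ q) :
    metricDimension (gridWithTriangle p q) = 2 := by
  classical
  refine metricDimension_eq ?_ ?_
  · refine ⟨Finset.disjSum {(⟨0, by omega⟩, ⟨q - 1, by omega⟩)} {0}, ?_, by simp⟩
    rw [isResolvingSet_gridWithTriangle_iff hp hq]
    refine ⟨⟨0, by simp⟩, ?_⟩
    rw [Finset.toLeft_disjSum]
    exact separatesSquares_of_corner_mem (Finset.mem_singleton_self _) (Or.inl ⟨rfl, rfl⟩)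
  · intro S hS
    obtain ⟨⟨i, hi⟩, hT⟩ := (isResolvingSet_gridWithTriangle_iff hp hq S).1 hS
    have h1 := (hT.nonempty hp hq).card_pos
    have h2 : 0 < S.toRight.card := Finset.card_pos.2 ⟨i, Finset.mem_toRight.2 hi⟩
    have h3 := Finset.card_toLeft_add_card_toRight (u := S)
    omega

theorem upperDimension_gridWithTriangle {p q : ℕ} (hp : 2 ≤ p) (hpq : p = q ∨ p + 1 = q) :
    upperDimension (gridWithTriangle p q) = p + q - 2 := by
  classical
  have hq : 2 ≤ q := by omega
  refine upperDimension_eq ?_ ?_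
  · obtain ⟨T, hT, hmin, hcard, -⟩ := exists_minimal_separatesSquares hp hpq
    refine ⟨T.disjSum {0}, isMinimalResolvingSet_iff.2 ⟨?_, ?_⟩, ?_⟩
    · rw [isResolvingSet_gridWithTriangle_iff hp hq, Finset.toLeft_disjSum]
      exact ⟨⟨0, by simp⟩, hT⟩
    · intro S hS hres
      obtain ⟨⟨i, hi⟩, hT'⟩ := (isResolvingSet_gridWithTriangle_iff hp hq S).1 hres
      have hsub : S.toLeft ⊆ T := by simpa using Finset.toLeft_subset_toLeft hS
      have hi' : i = 0 := by simpa using hS hi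
      refine Finset.Subset.antisymm hS ?_
      rintro (x | j) hx
      · rw [Finset.inl_mem_disjSum, ← hmin _ hsub hT'] at hx
        exact Finset.mem_toLeft.1 hx
      · rw [Finset.inr_mem_disjSum, Finset.mem_singleton] at hx
        rw [hx, ← hi']
        exact hi
    · rw [Finset.card_disjSum, hcard, Finset.card_singleton]
      omega
  · intro S hS
    obtain ⟨hres, hmin⟩ := isMinimalResolvingSet_iff.1 hS
    obtain ⟨⟨i, hi⟩, hT⟩ := (isResolvingSet_gridWithTriangle_iff hp hq S).1 hres
    have key : ∀ T' ⊆ S.toLeft, SeparatesSquares T' → T'.disjSum {i} = S := by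
      intro T' hsub hT'
      refine hmin _ ?_ ?_
      · rw [Finset.disjSum_subset]
        exact ⟨hsub, by simpa using hi⟩
      · rw [isResolvingSet_gridWithTriangle_iff hp hq, Finset.toLeft_disjSum]
        exact ⟨⟨i, by simp⟩, hT'⟩
    have hcard := card_le_of_minimal_separatesSquares hT fun T' hsub hT' => by
      rw [← key T' hsub hT', Finset.toLeft_disjSum]
    rw [← key _ subset_rfl hT, Finset.card_disjSum, Finset.card_singleton]
    omega

theorem card_le_card_toRight_add_one {α : Type*} {m : ℕ} {S : Finset (α ⊕ Fin m)}
    (h : ∀ i j : Fin m, i ≠ j → Sum.inr i ∈ S ∨ Sum.inr j ∈ S) :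
    m ≤ S.toRight.card + 1 := by
  have : (S.toRightᶜ).card ≤ 1 := by
    rw [Finset.card_le_one]
    intro i hi j hj
    by_contra hij
    simp only [Finset.mem_compl, Finset.mem_toRight] at hi hj
    exact (h i j hij).elim hi hj
  rw [Finset.card_compl, Fintype.card_fin] at this
  omega

theorem metricDimension_gridWithPendants {p q m : ℕ} (hp : 2 ≤ p) (hq : 2 ≤ q) (hm : 2 ≤ m) :
    metricDimension (gridWithPendants p q m) = m + 1 := by
  classical
  refine metricDimension_eq ?_ ?_
  · refine ⟨Finset.disjSum {(⟨0, by omega⟩, ⟨q - 1, by omega⟩)} Finset.univ, ?_, by simp [add_comm]⟩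
    rw [isResolvingSet_gridWithPendants_iff hp hq hm]
    refine ⟨by simp, ?_, by simp⟩
    rw [Finset.toLeft_disjSum]
    exact separatesSquares_of_corner_mem (Finset.mem_singleton_self _) (Or.inl ⟨rfl, rfl⟩)
  · intro S hS
    obtain ⟨hW, hT, hor⟩ := (isResolvingSet_gridWithPendants_iff hp hq hm S).1 hS
    have h3 := Finset.card_toLeft_add_card_toRight (u := S)
    have h4 := card_le_card_toRight_add_one hW
    rcases hor with hor | ⟨⟨w, hw, hw'⟩, v, hv, hv'⟩
    · have h1 := (hT.nonempty hp hq).card_pos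
      have h2 : S.toRight = Finset.univ := by
        ext i
        simpa using hor i
      rw [h2, Finset.card_univ, Fintype.card_fin] at h3
      omega
    · have : 1 < S.toLeft.card := by
        by_contra hcard
        have heq := Finset.card_le_one.1 (not_lt.1 hcard)
        obtain rfl := heq w hw v hv
        -- A single point off both axes cannot separate the square of which it is the upper corner.
        obtain ⟨z, hz, hs⟩ := hT (w.1 - 1) (w.2 - 1) (by omega) (by omega)
        rw [heq z hz w hw] at hs
        simp only [SeparatesSquare] at hs
        omega
      omega

theorem upperDimension_gridWithPendants {p q m : ℕ} (hp : 2 ≤ p) (hpq : p = q ∨ p + 1 = q)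
    (h5 : 5 ≤ p + q) (hm : 2 ≤ m) :
    upperDimension (gridWithPendants p q m) = m - 1 + (p + q - 3) := by
  classical
  have hq : 2 ≤ q := by omega
  refine upperDimension_eq ?_ ?_
  · obtain ⟨T, hT, hmin, hcard, hcorner⟩ := exists_minimal_separatesSquares hp hpq
    let i₀ : Fin m := ⟨0, by omega⟩
    refine ⟨T.disjSum (Finset.univ.erase i₀), isMinimalResolvingSet_iff.2 ⟨?_, ?_⟩, ?_⟩
    · rw [isResolvingSet_gridWithPendants_iff hp hq hm, Finset.toLeft_disjSum]
      refine ⟨?_, hT, Or.inr (hT.exists_pos_of_no_corner hp hq (hcorner h5))⟩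
      intro i j hij
      by_contra! hcon
      simp only [Finset.inr_mem_disjSum, Finset.mem_erase, Finset.mem_univ, and_true,
        not_not] at hcon
      exact hij (hcon.1.trans hcon.2.symm)
    · intro S hS hres
      obtain ⟨hW, hT', -⟩ := (isResolvingSet_gridWithPendants_iff hp hq hm S).1 hres
      have hsub : S.toLeft ⊆ T := by simpa using Finset.toLeft_subset_toLeft hS
      have hi₀ : Sum.inr i₀ ∉ S := fun h => by simpa using hS h
      refine Finset.Subset.antisymm hS ?_
      rintro (x | j) hx
      · rw [Finset.inl_mem_disjSum, ← hmin _ hsub hT'] at hx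
        exact Finset.mem_toLeft.1 hx
      · rw [Finset.inr_mem_disjSum, Finset.mem_erase] at hx
        exact (hW j i₀ hx.1).resolve_right hi₀
    · rw [Finset.card_disjSum, hcard, Finset.card_erase_of_mem (Finset.mem_univ _),
        Finset.card_univ, Fintype.card_fin]
      omega
  · intro S hS
    obtain ⟨hres, hmin⟩ := isMinimalResolvingSet_iff.1 hS
    obtain ⟨hW, hT, hor⟩ := (isResolvingSet_gridWithPendants_iff hp hq hm S).1 hres
    have hcardS := Finset.card_toLeft_add_card_toRight (u := S)
    have hright : S.toRight.card ≤ m := by simpa using Finset.card_le_univ S.toRight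
    have key : ∀ T' ⊆ S.toLeft, SeparatesSquares T' → ((∀ i, Sum.inr i ∈ S) ∨
        ((∃ w ∈ T', 0 < w.1.val) ∧ ∃ w ∈ T', 0 < w.2.val)) → T' = S.toLeft := by
      intro T' hsub hT' hor'
      have : T'.disjSum S.toRight = S := by
        refine hmin _ ?_ ?_
        · rw [Finset.disjSum_subset]
          exact ⟨hsub, subset_rfl⟩
        · rw [isResolvingSet_gridWithPendants_iff hp hq hm, Finset.toLeft_disjSum]
          simpa only [Finset.inr_mem_disjSum, Finset.mem_toRight] using ⟨hW, hT', hor'⟩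
      rw [← this, Finset.toLeft_disjSum]
    -- With a corner, minimality leaves one grid vertex and all `m` pendants, or at most two grid
    -- vertices and at most `m - 1` pendants; both fit since `p + q - 3 ≥ 2`. Without one, the
    -- positivity condition is automatic, so some pendant is missing and the square bound applies.
    by_cases hcorner : ∃ c ∈ S.toLeft,
        (c.1.val = 0 ∧ c.2.val = q - 1) ∨ (c.1.val = p - 1 ∧ c.2.val = 0)
    · obtain ⟨c, hc, hcc⟩ := hcorner
      by_cases hall : ∀ i, Sum.inr i ∈ S
      · have := key {c} (by simpa using hc)
          (separatesSquares_of_corner_mem (Finset.mem_singleton_self _) hcc) (Or.inl hall)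
        rw [← this, Finset.card_singleton] at hcardS
        omega
      · obtain ⟨⟨w, hw, hw'⟩, v, hv, hv'⟩ := hor.resolve_left hall
        have hlt : S.toRight.card < m := by
          push Not at hall
          obtain ⟨i, hi⟩ := hall
          simpa using Finset.card_lt_univ_of_notMem (s := S.toRight) (x := i) (by simpa using hi)
        obtain ⟨e, he, hpos⟩ : ∃ e ∈ S.toLeft, (0 < c.1.val ∨ 0 < e.1.val) ∧
            (0 < c.2.val ∨ 0 < e.2.val) := by
          rcases hcc with hcc | hcc
          · exact ⟨w, hw, Or.inr hw', Or.inl (by omega)⟩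
          · exact ⟨v, hv, Or.inl (by omega), Or.inr hv'⟩
        have := key {c, e} (by simp [Finset.insert_subset_iff, hc, he])
          (separatesSquares_of_corner_mem (Finset.mem_insert_self _ _) hcc)
          (Or.inr (by simpa using hpos))
        have hle := Finset.card_le_two (a := c) (b := e)
        rw [this] at hle
        omega
    · have hno : ∀ T' ⊆ S.toLeft, SeparatesSquares T' →
          (∃ w ∈ T', 0 < w.1.val) ∧ ∃ w ∈ T', 0 < w.2.val := fun T' hsub hT' =>
        hT'.exists_pos_of_no_corner hp hq fun w hw =>
          not_or.1 fun h => hcorner ⟨w, hsub hw, h⟩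
      have hcard := card_le_of_minimal_separatesSquares hT fun T' hsub hT' =>
        key T' hsub hT' (Or.inr (hno T' hsub hT'))
      have hlt : S.toRight.card < m := by
        by_contra hge
        have huniv : S.toRight = Finset.univ :=
          Finset.card_eq_iff_eq_univ _ |>.1 (by rw [Fintype.card_fin]; omega)
        let i₀ : Fin m := ⟨0, by omega⟩
        have hres' : IsResolvingSet (gridWithPendants p q m) (S.erase (Sum.inr i₀)) := by
          have hleft : (S.erase (Sum.inr i₀)).toLeft = S.toLeft := by
            ext x
            simp
          have hmem : ∀ i, Sum.inr i ∈ S := fun i =>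
            Finset.mem_toRight.1 (huniv ▸ Finset.mem_univ i)
          rw [isResolvingSet_gridWithPendants_iff hp hq hm, hleft]
          refine ⟨?_, hT, Or.inr (hno _ subset_rfl hT)⟩
          intro i j hij
          by_contra! hcon
          simp only [Finset.mem_erase, hmem, and_true, ne_eq, not_not, Sum.inr.injEq] at hcon
          exact hij (hcon.1.trans hcon.2.symm)
        have heq := hmin _ (Finset.erase_subset _ _) hres'
        have : Sum.inr i₀ ∈ S := Finset.mem_toRight.1 (huniv ▸ Finset.mem_univ i₀)
        rw [← heq] at this
        exact absurd this (Finset.notMem_erase _ _)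
      omega

theorem theorem2 (a b : ℕ) (ha : 2 ≤ a) (hab : a ≤ b) :
    ∃ (V : Type) (_ : Fintype V) (G : SimpleGraph V),
      G.Connected ∧ metricDimension G = a ∧ upperDimension G = b ∧ IsExtendedGrid G := by
  rcases Nat.eq_or_lt_of_le ha with rfl | ha
  -- The sides are the halves of `p + q = b + 2`.
  · have hp : 2 ≤ (b + 2) / 2 := by omega
    have hpq : (b + 2) / 2 = (b + 3) / 2 ∨ (b + 2) / 2 + 1 = (b + 3) / 2 := by omega
    refine ⟨_, inferInstance, gridWithTriangle ((b + 2) / 2) ((b + 3) / 2),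
      attachAtOrigin_connected (by omega) (by omega) _ 1 (Or.inl ⟨rfl, rfl⟩),
      metricDimension_gridWithTriangle hp (by omega), ?_,
      (b + 3) / 2, (b + 2) / 2, by omega, hpq, Or.inl ⟨SimpleGraph.Iso.refl⟩⟩
    rw [upperDimension_gridWithTriangle hp hpq]
    omega
  -- With `m = a - 1`, solving for the upper dimension gives `p + q = b - a + 5`, which is at least
  -- `5`.
  · have hp : 2 ≤ (b - a + 5) / 2 := by omega
    have hpq : (b - a + 5) / 2 = (b - a + 6) / 2 ∨ (b - a + 5) / 2 + 1 = (b - a + 6) / 2 := by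
      omega
    refine ⟨_, inferInstance, gridWithPendants ((b - a + 5) / 2) ((b - a + 6) / 2) (a - 1),
      attachAtOrigin_connected (by omega) (by omega) _ 2 (Or.inr ⟨rfl, rfl⟩), ?_, ?_,
      (b - a + 6) / 2, (b - a + 5) / 2, by omega, hpq,
      Or.inr ⟨a - 1, by omega, ⟨SimpleGraph.Iso.refl⟩⟩⟩
    · rw [metricDimension_gridWithPendants hp (by omega) (by omega)]
      omega
    · rw [upperDimension_gridWithPendants hp hpq (by omega) (by omega)]
      omega
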